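/- \textbf{Types and functionals.} The finite types are $0$ and $(\sigma_1,\dots,\sigma_n\to 0)$ for types $\sigma_1,\dots,\sigma_n$, $n\ge 1$; we identify $(\sigma_1,\dots,\sigma_n\to 0)$ with $\sigma_1\to(\sigma_2,\dots,\sigma_n\to 0)$. The rank is $\mathbf r(0)=0$, $\mathbf r(\sigma_1,\dots,\sigma_n\to0)=\max_i(\mathbf r(\sigma_i)+1)$, and $\mathbf{Ty}(k)$ is the set of types of rank $\le k$. Put $\mathbf F(0)=\mathbb N$, $\mathbf P(0)=\mathbb N_\bot=\mathbb N\cup\{\bot\}$, and for $\sigma=(\sigma_1,\dots,\sigma_n\to0)$ let $\mathbf F(\sigma)$ (resp. $\mathbf P(\sigma)$) be the set of all functions from $\mathbf F(\sigma_1)\times\dots\times\mathbf F(\sigma_n)$ to $\mathbb N$ (resp. to $\mathbb N_\bot$), so that $\mathbf F(\sigma)\subseteq\mathbf P(\sigma)$. For $\phi,\psi\in\mathbf P(\sigma)$, $\phi\preceq\psi$ means that $\psi$ extends $\phi$: wherever $\phi$ is defined (not $\bot$), $\psi$ is defined with the same value. \textbf{Terms.} Typed terms are built from: the constants $\hat 0$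 of type $0$, $\mathsf{suc},\mathsf{pred}$ of type $0\to0$ and $\mathsf{case}$ of type $0,0,0\to0$; variables $x_i^\sigma$ ($i\in\mathbb N$, $\sigma\in\mathbf{Ty}(3)$); a secondary constant $\hat\phi$ for each $\phi\in\mathbf P(\sigma)$, $\sigma\in\mathbf{Ty}(3)$; application $(ts)$ of type $\tau$ for $t$ of type $\sigma\to\tau$ and $s$ of type $\sigma$; abstraction $\lambda x_i^\sigma t$ of type $\sigma\to\tau$ for $t$ of type $\tau$, if $\mathbf r(\sigma\to\tau)\le3$; and $\mu x_i^\sigma t$ of type $\sigma$ for $t$ of type $\sigma\in\mathbf{Ty}(3)$. \textbf{Interpretation.} Given an assignment of elements of $\mathbf P(\sigma)$ to the variables $x_i^\sigma$, a term $t$ of type $\tau$ is interpreted as $[[t]]\in\mathbf P(\tau)$: variables by the assignment, $\hat\phi$ by $\phi$, $\hat0$ by $0$, $\mathsf{suc}$ and $\mathsf{pred}$ by successor and predecessor (with $\mathsf{pred}(0)=0$), $\mathsf{case}(0,x,y)=x$ and $\mathsf{case}(z+1,x,y)=y$; $[[ts]]=[[t]]([[s]])$ if $[[s]]$ is total, and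 $[[ts]]$ is everywhere undefined otherwise, except that $[[\mathsf{case}\,t_1t_2t_3]]$ only requires $[[t_1]]$ and the selected one of $[[t_2]],[[t_3]]$ to be defined; $[[\lambda x_i^\sigma t]]$ sends $f\in\mathbf F(\sigma)$ to the value of $[[t]]$ with $f$ assigned to $x_i^\sigma$; $[[\mu x_i^\sigma t]]$ is the $\preceq$-least fixed point of the monotone map sending $\psi\in\mathbf P(\sigma)$ to the value of $[[t]]$ with $\psi$ assigned to $x_i^\sigma$. \textbf{Computability.} Let $\Phi\in\mathbf P(\tau)$ and $\Phi_i\in\mathbf P(\sigma_i)$ ($i=1,\dots,n$), with all types in $\mathbf{Ty}(3)$. Then $\Phi$ is \emph{computable in} $\Phi_1,\dots,\Phi_n$ if there is a term $s$ of type $\tau$ without secondary constants, with free variables among distinct variables $x_1,\dots,x_n$ of types $\sigma_1,\dots,\sigma_n$, such that $\Phi\preceq[[s(x_1,\dots,x_n/\hat\Phi_1,\dots,\hat\Phi_n)]]$. \textbf{Countably based functionals.} Let $\sigma=(\tau_1,\dots,\tau_m\to0)\in\mathbf{Ty}(3)$ with $\tau_i=(\delta_{i,1},\dots,\delta_{i,m_i}\to0)$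 ($m,m_i\ge0$, where length $0$ means type $0$, and an empty product is a one-point set). A functional $\Psi\in\mathbf P(\sigma)$ is \emph{countably based} if, whenever $\Psi(F_1,\dots,F_m)\in\mathbb N$, there are countable sets $X_i\subseteq\mathbf F(\delta_{i,1})\times\dots\times\mathbf F(\delta_{i,m_i})$ ($i=1,\dots,m$) such that $\Psi(F_1,\dots,F_m)=\Psi(G_1,\dots,G_m)$ whenever $\Psi(G_1,\dots,G_m)\in\mathbb N$ and $F_i$, $G_i$ are equal on $X_i$ for each $i$. (Here $F_i,G_i\in\mathbf F(\tau_i)$ are total.) \textbf{Theorem.} Let $\Phi,\Phi_1,\dots,\Phi_n$ be partial functionals, i.e. elements of $\mathbf P(\tau),\mathbf P(\sigma_1),\dots,\mathbf P(\sigma_n)$, of types in $\mathbf{Ty}(3)$. If $\Phi$ is computable in $\Phi_1,\dots,\Phi_n$ and each $\Phi_i$ is countably based, then $\Phi$ is countably based. -/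

import Mathlib

namespace PartialFun

/-- Finite types, in curried form: `arr σ₁ (arr σ₂ (… (arr σₙ nat)))` is `(σ₁,…,σₙ → 0)`. -/
inductive Ty : Type
  | nat : Ty
  | arr : Ty → Ty → Ty
  deriving DecidableEq

namespace Ty

/-- The rank: `r(0) = 0` and `r(σ₁,…,σₙ → 0) = max (r(σᵢ) + 1)`. -/
def rank : Ty → ℕ
  | nat => 0
  | arr σ τ => max (rank σ + 1) (rank τ)

end Ty

/-- `F(σ)`: the total functionals, i.e. all functions `F(σ₁) × ⋯ × F(σₙ) → ℕ` (curried). -/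
def Tot : Ty → Type
  | .nat => ℕ
  | .arr σ τ => Tot σ → Tot τ

/-- `P(σ)`: the partial functionals, i.e. all functions `F(σ₁) × ⋯ × F(σₙ) → ℕ ∪ {⊥}` (curried),
where `none` stands for `⊥`. The arguments are always total. -/
def Par : Ty → Type
  | .nat => Option ℕ
  | .arr σ τ => Tot σ → Par τ

/-- The product `F(σ₁) × ⋯ × F(σₙ)` for `σ = (σ₁,…,σₙ → 0)` (a one-point set for `σ = 0`). -/
def Args : Ty → Type
  | .nat => Unit
  | .arr σ τ => Tot σ × Args τ

/-- The value of a total functional at a full tuple of arguments. -/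
def Tot.eval : {σ : Ty} → Tot σ → Args σ → ℕ
  | .nat, n, _ => n
  | .arr _ _, f, a => Tot.eval (f a.1) a.2

/-- The value in `ℕ ∪ {⊥}` of a partial functional at a full tuple of arguments. -/
def Par.eval : {σ : Ty} → Par σ → Args σ → Option ℕ
  | .nat, n, _ => n
  | .arr _ _, f, a => Par.eval (f a.1) a.2

/-- The inclusion `F(σ) ⊆ P(σ)`. -/
def Tot.toPar : {σ : Ty} → Tot σ → Par σ
  | .nat, n => some n
  | .arr _ _, f => fun x => Tot.toPar (f x)

/-- The everywhere undefined element of `P(σ)`. -/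
def Par.bot : (σ : Ty) → Par σ
  | .nat => none
  | .arr _ τ => fun _ => Par.bot τ

/-- The extension order on `P(σ)`: wherever `φ` is defined, `ψ` is defined with the same value. -/
def Par.Le {σ : Ty} (φ ψ : Par σ) : Prop :=
  ∀ (a : Args σ) (k : ℕ), φ.eval a = some k → ψ.eval a = some k

open Classical in
/-- Application in `P`: everywhere undefined unless the argument is total. -/
noncomputable def Par.app {σ τ : Ty} (φ : Par (.arr σ τ)) (ψ : Par σ) : Par τ :=
  if h : ∃ f : Tot σ, f.toPar = ψ then φ h.choose else Par.bot τ

/-- `ψ` is the least fixed point of `f`. -/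
def Par.IsLeastFixedPoint {σ : Ty} (f : Par σ → Par σ) (ψ : Par σ) : Prop :=
  f ψ = ψ ∧ ∀ χ, f χ = χ → ψ.Le χ

open Classical in
/-- The least fixed point of `f`; for monotone `f` it exists, see `Par.lfp_spec`. -/
noncomputable def Par.lfp {σ : Ty} (f : Par σ → Par σ) : Par σ :=
  if h : ∃ ψ, Par.IsLeastFixedPoint f ψ then h.choose else Par.bot σ

theorem Par.eval_bot : {σ : Ty} → (a : Args σ) → (Par.bot σ).eval a = none
  | .nat, _ => rfl
  | .arr _ _, a => Par.eval_bot a.2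

theorem Par.ext_eval : {σ : Ty} → {φ ψ : Par σ} → (∀ a, φ.eval a = ψ.eval a) → φ = ψ
  | .nat, _, _, h => h ()
  | .arr _ _, _, _, h => funext fun x => Par.ext_eval fun a => h (x, a)

theorem Tot.eval_toPar : {σ : Ty} → (f : Tot σ) → (a : Args σ) → f.toPar.eval a = some (f.eval a)
  | .nat, _, _ => rfl
  | .arr _ _, f, a => Tot.eval_toPar (f a.1) a.2

theorem Tot.toPar_injective : {σ : Ty} → Function.Injective (Tot.toPar (σ := σ))
  | .nat, _, _, h => Option.some.inj h
  | .arr _ _, _, _, h => funext fun x => Tot.toPar_injective (congrFun h x)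

theorem Par.Le.refl {σ : Ty} (φ : Par σ) : φ.Le φ := fun _ _ h => h

theorem Par.Le.of_eq {σ : Ty} {φ ψ : Par σ} (h : φ = ψ) : φ.Le ψ := h ▸ Par.Le.refl φ

theorem Par.Le.trans {σ : Ty} {φ ψ χ : Par σ} (h : φ.Le ψ) (h' : ψ.Le χ) : φ.Le χ :=
  fun a k e => h' a k (h a k e)

theorem Par.Le.antisymm {σ : Ty} {φ ψ : Par σ} (h : φ.Le ψ) (h' : ψ.Le φ) : φ = ψ :=
  Par.ext_eval fun a => Option.ext fun k => ⟨h a k, h' a k⟩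

theorem Par.bot_le {σ : Ty} (φ : Par σ) : (Par.bot σ).Le φ := fun a k h => by
  rw [Par.eval_bot] at h; cases h

theorem Par.eq_toPar_of_le {σ : Ty} {f : Tot σ} {ψ : Par σ} (h : f.toPar.Le ψ) : ψ = f.toPar :=
  Par.ext_eval fun a => by rw [h a _ (f.eval_toPar a), f.eval_toPar]

theorem Par.app_toPar {σ τ : Ty} (φ : Par (.arr σ τ)) (f : Tot σ) : φ.app f.toPar = φ f := by
  have h : ∃ g : Tot σ, g.toPar = f.toPar := ⟨f, rfl⟩
  rw [Par.app, dif_pos h, Tot.toPar_injective h.choose_spec]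

theorem Par.app_eq_bot {σ τ : Ty} (φ : Par (.arr σ τ)) {ψ : Par σ}
    (h : ¬ ∃ f : Tot σ, f.toPar = ψ) : φ.app ψ = Par.bot τ := dif_neg h

theorem Par.app_mono {σ τ : Ty} {φ φ' : Par (.arr σ τ)} {ψ ψ' : Par σ} (h : φ.Le φ')
    (h' : ψ.Le ψ') : (φ.app ψ).Le (φ'.app ψ') := by
  by_cases ht : ∃ f : Tot σ, f.toPar = ψ
  · obtain ⟨f, rfl⟩ := ht
    rw [Par.eq_toPar_of_le h', Par.app_toPar, Par.app_toPar]
    exact fun a k e => h (f, a) k e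
  · rw [Par.app_eq_bot φ ht]
    exact Par.bot_le _

/-- The partial functional with a given evaluation. -/
def Par.ofEval : {σ : Ty} → (Args σ → Option ℕ) → Par σ
  | .nat, e => e ()
  | .arr _ _, e => fun x => Par.ofEval fun a => e (x, a)

theorem Par.eval_ofEval : {σ : Ty} → (e : Args σ → Option ℕ) → (a : Args σ) →
    (Par.ofEval e).eval a = e a
  | .nat, _, _ => rfl
  | .arr _ _, e, a => Par.eval_ofEval (fun b => e (a.1, b)) a.2

/-- Every chain of partial functionals has a supremum. -/
theorem Par.exists_chain_sup {σ : Ty} (c : Set (Par σ))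
    (hc : ∀ φ ∈ c, ∀ ψ ∈ c, φ.Le ψ ∨ ψ.Le φ) :
    ∃ u : Par σ, (∀ φ ∈ c, φ.Le u) ∧ ∀ a k, u.eval a = some k → ∃ φ ∈ c, φ.eval a = some k := by
  classical
  refine ⟨Par.ofEval fun a =>
    if h : ∃ k, ∃ φ ∈ c, φ.eval a = some k then some h.choose else none, ?_, ?_⟩
  · intro φ hφ a k hk
    have h : ∃ k, ∃ φ ∈ c, φ.eval a = some k := ⟨k, φ, hφ, hk⟩
    rw [Par.eval_ofEval, dif_pos h]
    obtain ⟨ψ, hψ, e⟩ := h.choose_spec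
    rcases hc φ hφ ψ hψ with l | l
    · rw [← e, l a k hk]
    · rw [← hk, l a _ e]
  · intro a k hk
    rw [Par.eval_ofEval] at hk
    split_ifs at hk with h
    obtain ⟨ψ, hψ, e⟩ := h.choose_spec
    exact ⟨ψ, hψ, e.trans hk⟩

/-- A monotone map on partial functionals has a fixed point below all pre-fixed points. -/
theorem Par.exists_lfp {σ : Ty} (f : Par σ → Par σ) (hf : ∀ φ ψ, φ.Le ψ → (f φ).Le (f ψ)) :
    ∃ ψ, f ψ = ψ ∧ ∀ χ, (f χ).Le χ → ψ.Le χ := by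
  let A : Set (Par σ) := {ψ | ψ.Le (f ψ) ∧ ∀ χ, (f χ).Le χ → ψ.Le χ}
  obtain ⟨m, hm⟩ := exists_maximal_of_chains_bounded (α := A) (r := fun φ ψ => φ.1.Le ψ.1)
    (fun c hc => by
      have tot : ∀ φ ∈ Subtype.val '' c, ∀ ψ ∈ Subtype.val '' c, φ.Le ψ ∨ ψ.Le φ := by
        rintro _ ⟨φ, hφ, rfl⟩ _ ⟨ψ, hψ, rfl⟩
        by_cases e : φ = ψ
        · exact Or.inl (e ▸ Par.Le.refl _)
        · exact hc hφ hψ e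
      obtain ⟨u, hu, hu'⟩ := Par.exists_chain_sup (Subtype.val '' c) tot
      refine ⟨⟨u, fun a k hk => ?_, fun χ hχ a k hk => ?_⟩, fun φ hφ => hu _ ⟨φ, hφ, rfl⟩⟩
      · obtain ⟨φ, hφ, e⟩ := hu' a k hk
        have l := hf _ _ (hu φ hφ)
        obtain ⟨φ, _, rfl⟩ := hφ
        exact l a k (φ.2.1 a k e)
      · obtain ⟨_, ⟨φ, _, rfl⟩, e⟩ := hu' a k hk
        exact φ.2.2 χ hχ a k e)
    (fun h h' => h.trans h')
  have hfm : f m.1 ∈ A := ⟨hf _ _ m.2.1, fun χ hχ => (hf _ _ (m.2.2 χ hχ)).trans hχ⟩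
  exact ⟨m.1, (hm ⟨f m.1, hfm⟩ m.2.1).antisymm m.2.1, m.2.2⟩

/-- For monotone `f`, the functional `Par.lfp f` is the least fixed point of `f`. -/
theorem Par.lfp_spec {σ : Ty} (f : Par σ → Par σ) (hf : ∀ φ ψ, φ.Le ψ → (f φ).Le (f ψ)) :
    Par.IsLeastFixedPoint f (Par.lfp f) := by
  obtain ⟨ψ, hψ, hle⟩ := Par.exists_lfp f hf
  have h : ∃ ψ, Par.IsLeastFixedPoint f ψ := ⟨ψ, hψ, fun χ hχ => hle χ (hχ.symm ▸ Par.Le.refl χ)⟩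
  rw [Par.lfp, dif_pos h]
  exact h.choose_spec

theorem Par.lfp_le {σ : Ty} (f : Par σ → Par σ) (hf : ∀ φ ψ, φ.Le ψ → (f φ).Le (f ψ))
    {χ : Par σ} (hχ : (f χ).Le χ) : (Par.lfp f).Le χ := by
  obtain ⟨ψ, hψ, hle⟩ := Par.exists_lfp f hf
  exact ((Par.lfp_spec f hf).2 ψ hψ).trans (hle χ hχ)

/-- Terms. For every type of rank at most three there are variables `x_i^σ` (`var i σ`) and a
secondary constant for each element of `P(σ)`. The constant `case` denotes a total object, so that
`app` (which needs total arguments) would make it strict; as `case t₁ t₂ t₃` only evaluates the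
selected branch, the full application of `case` to three terms has its own constructor `caseOf`. -/
inductive Term : Ty → Type
  | zero : Term .nat
  | suc : Term (.arr .nat .nat)
  | pred : Term (.arr .nat .nat)
  | case : Term (.arr .nat (.arr .nat (.arr .nat .nat)))
  | caseOf (t₁ t₂ t₃ : Term .nat) : Term .nat
  | var (i : ℕ) (σ : Ty) (hσ : σ.rank ≤ 3) : Term σ
  | const {σ : Ty} (hσ : σ.rank ≤ 3) (φ : Par σ) : Term σ
  | app {σ τ : Ty} (t : Term (.arr σ τ)) (s : Term σ) : Term τ
  | lam (i : ℕ) (σ : Ty) {τ : Ty} (h : (Ty.arr σ τ).rank ≤ 3) (t : Term τ) : Term (.arr σ τ)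
  | mu (i : ℕ) (σ : Ty) (hσ : σ.rank ≤ 3) (t : Term σ) : Term σ

/-- Assignments of partial objects to all variables `x_i^σ`. -/
abbrev Env : Type := (σ : Ty) → ℕ → Par σ

/-- The assignment `ρ` with the value at `x_i^σ` replaced by `φ`. -/
def Env.set (ρ : Env) (i : ℕ) (σ : Ty) (φ : Par σ) : Env :=
  fun τ j => if h : σ = τ ∧ i = j then h.1 ▸ φ else ρ τ j

/-- The value `case(z, x, y)`: `z` has to be defined, and then only the selected one of `x`, `y`
has to be defined. -/
def caseVal : Option ℕ → Option ℕ → Option ℕ → Option ℕ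
  | none, _, _ => none
  | some 0, x, _ => x
  | some (_ + 1), _, y => y

/-- The interpretation `[[t]]`. -/
noncomputable def Term.interp : {σ : Ty} → Term σ → Env → Par σ
  | _, .zero, _ => some (0 : ℕ)
  | _, .suc, _ => fun n : ℕ => some (n + 1)
  | _, .pred, _ => fun n : ℕ => some (n - 1)
  | _, .case, _ => fun z x y : ℕ => caseVal (some z) (some x) (some y)
  | _, .caseOf t₁ t₂ t₃, ρ => caseVal (t₁.interp ρ) (t₂.interp ρ) (t₃.interp ρ)
  | _, .var i σ _, ρ => ρ σ i
  | _, .const _ φ, _ => φ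
  | _, .app t s, ρ => Par.app (t.interp ρ) (s.interp ρ)
  | _, .lam i σ _ t, ρ => fun f : Tot σ => t.interp (ρ.set i σ f.toPar)
  | _, .mu i σ _ t, ρ => Par.lfp fun ψ : Par σ => t.interp (ρ.set i σ ψ)

theorem caseVal_mono {z z' x x' y y' : Option ℕ} (hz : ∀ k, z = some k → z' = some k)
    (hx : ∀ k, x = some k → x' = some k) (hy : ∀ k, y = some k → y' = some k) (k : ℕ)
    (h : caseVal z x y = some k) : caseVal z' x' y' = some k := by
  match z, h with
  | some 0, h => rw [hz 0 rfl]; exact hx k h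
  | some (m + 1), h => rw [hz (m + 1) rfl]; exact hy k h

theorem Env.set_mono {ρ ρ' : Env} (h : ∀ σ i, (ρ σ i).Le (ρ' σ i)) (i : ℕ) (σ : Ty)
    {φ φ' : Par σ} (hφ : φ.Le φ') : ∀ τ j, (ρ.set i σ φ τ j).Le (ρ'.set i σ φ' τ j) := by
  intro τ j
  unfold Env.set
  split_ifs with e
  · obtain ⟨rfl, rfl⟩ := e
    exact hφ
  · exact h τ j

/-- The interpretation is monotone. -/
theorem Term.interp_mono {σ : Ty} (t : Term σ) : ∀ {ρ ρ' : Env},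
    (∀ σ i, (ρ σ i).Le (ρ' σ i)) → (t.interp ρ).Le (t.interp ρ') := by
  induction t with
  | zero => exact fun _ => Par.Le.refl _
  | suc => exact fun _ => Par.Le.refl _
  | pred => exact fun _ => Par.Le.refl _
  | case => exact fun _ => Par.Le.refl _
  | caseOf t₁ t₂ t₃ h₁ h₂ h₃ =>
    exact fun h _ => caseVal_mono (h₁ h ()) (h₂ h ()) (h₃ h ())
  | var i σ hσ => exact fun h => h σ i
  | const hσ φ => exact fun _ => Par.Le.refl _
  | app t s ht hs => exact fun h => Par.app_mono (ht h) (hs h)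
  | lam i σ hr t ht =>
    exact fun h a => ht (Env.set_mono h i σ (Par.Le.refl _)) a.2
  | mu i σ hσ t ht =>
    intro ρ ρ' h
    have m : ∀ ρ : Env, ∀ φ ψ : Par σ, φ.Le ψ →
        (t.interp (ρ.set i σ φ)).Le (t.interp (ρ.set i σ ψ)) :=
      fun ρ φ ψ l => ht (Env.set_mono (fun _ _ => Par.Le.refl _) i σ l)
    refine Par.lfp_le _ (m ρ) ((ht (Env.set_mono h i σ (Par.Le.refl _))).trans ?_)
    exact Par.Le.of_eq (Par.lfp_spec _ (m ρ')).1

/-- The interpretation of `μ x. t` is the least fixed point. -/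
theorem Term.interp_mu {σ : Ty} (i : ℕ) (hσ : σ.rank ≤ 3) (t : Term σ) (ρ : Env) :
    Par.IsLeastFixedPoint (fun ψ => t.interp (ρ.set i σ ψ)) ((Term.mu i σ hσ t).interp ρ) :=
  Par.lfp_spec _ fun _ _ l => t.interp_mono (Env.set_mono (fun _ _ => Par.Le.refl _) i σ l)

/-- `t` contains no secondary constants. -/
def Term.NoConst : {σ : Ty} → Term σ → Prop
  | _, .zero => True
  | _, .suc => True
  | _, .pred => True
  | _, .case => True
  | _, .caseOf t₁ t₂ t₃ => t₁.NoConst ∧ t₂.NoConst ∧ t₃.NoConst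
  | _, .var _ _ _ => True
  | _, .const _ _ => False
  | _, .app t s => t.NoConst ∧ s.NoConst
  | _, .lam _ _ _ t => t.NoConst
  | _, .mu _ _ _ t => t.NoConst

/-- The set of free variables of a term, `(τ, j)` standing for `x_j^τ`. -/
def Term.freeVars : {σ : Ty} → Term σ → Set (Ty × ℕ)
  | _, .zero => ∅
  | _, .suc => ∅
  | _, .pred => ∅
  | _, .case => ∅
  | _, .caseOf t₁ t₂ t₃ => t₁.freeVars ∪ t₂.freeVars ∪ t₃.freeVars
  | _, .var i σ _ => {(σ, i)}
  | _, .const _ _ => ∅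
  | _, .app t s => t.freeVars ∪ s.freeVars
  | _, .lam i σ _ t => t.freeVars \ {(σ, i)}
  | _, .mu i σ _ t => t.freeVars \ {(σ, i)}

/-- Replacements `x_i^σ ↦ φ` of variables by partial objects. -/
abbrev Repl : Type := (σ : Ty) → ℕ → Option (Par σ)

/-- The replacement `θ`, except that `x_i^σ` is not replaced. -/
def Repl.erase (θ : Repl) (i : ℕ) (σ : Ty) : Repl :=
  fun τ j => if σ = τ ∧ i = j then none else θ τ j

/-- Simultaneous substitution of secondary constants for free variables. -/
def Term.subst : {σ : Ty} → Term σ → Repl → Term σ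
  | _, .zero, _ => .zero
  | _, .suc, _ => .suc
  | _, .pred, _ => .pred
  | _, .case, _ => .case
  | _, .caseOf t₁ t₂ t₃, θ => .caseOf (t₁.subst θ) (t₂.subst θ) (t₃.subst θ)
  | _, .var i σ hσ, θ =>
    match θ σ i with
    | none => .var i σ hσ
    | some φ => .const hσ φ
  | _, .const hσ φ, _ => .const hσ φ
  | _, .app t s, θ => .app (t.subst θ) (s.subst θ)
  | _, .lam i σ h t, θ => .lam i σ h (t.subst (θ.erase i σ))
  | _, .mu i σ hσ t, θ => .mu i σ hσ (t.subst (θ.erase i σ))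

open Classical in
/-- The replacement of the variables `x_{v 0}^{σ 0}, …, x_{v (n-1)}^{σ (n-1)}` by
`φ 0, …, φ (n-1)`. -/
noncomputable def Repl.ofList {n : ℕ} (σ : Fin n → Ty) (v : Fin n → ℕ) (φ : (i : Fin n) → Par (σ i)) :
    Repl :=
  fun τ j => if h : ∃ i, σ i = τ ∧ v i = j then some (h.choose_spec.1 ▸ φ h.choose) else none

/-- `ψ` is computable in `φ 0, …, φ (n-1)`: there is a term `s` without secondary constants, with
free variables among the pairwise different variables `x_{v i}^{σ i}`, such that `ψ` is extended
by the interpretation of the closed term obtained from `s` by putting `φ i` for `x_{v i}^{σ i}`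
(the assignment used for interpreting the closed term is irrelevant). -/
def Computable {τ : Ty} (ψ : Par τ) {n : ℕ} (σ : Fin n → Ty) (φ : (i : Fin n) → Par (σ i)) : Prop :=
  ∃ (s : Term τ) (v : Fin n → ℕ),
    Function.Injective (fun i => (σ i, v i)) ∧
    s.NoConst ∧
    s.freeVars ⊆ Set.range (fun i => (σ i, v i)) ∧
    ψ.Le ((s.subst (Repl.ofList σ v φ)).interp fun τ' _ => Par.bot τ')

/-- For `σ = (τ₁,…,τₙ → 0)` with `τᵢ = (δᵢ₁,…,δᵢₘ → 0)`: families `(X₁,…,Xₙ)` of subsets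
`Xᵢ ⊆ F(δᵢ₁) × ⋯ × F(δᵢₘ)`. -/
def Supp : Ty → Type
  | .nat => Unit
  | .arr τ ρ => Set (Args τ) × Supp ρ

/-- All `Xᵢ` are countable. -/
def Supp.Countable : {σ : Ty} → Supp σ → Prop
  | .nat, _ => True
  | .arr _ _, X => X.1.Countable ∧ Supp.Countable X.2

/-- `Fᵢ` and `Gᵢ` are equal on `Xᵢ`, for all `i`. -/
def Supp.Agree : {σ : Ty} → Supp σ → Args σ → Args σ → Prop
  | .nat, _, _, _ => True
  | .arr _ _, X, F, G => (∀ a ∈ X.1, F.1.eval a = G.1.eval a) ∧ Supp.Agree X.2 F.2 G.2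

/-- Countably based partial functionals: every value `Φ(F₁,…,Fₙ) ∈ ℕ` has countable sets
`X₁,…,Xₙ` such that `Φ(F₁,…,Fₙ) = Φ(G₁,…,Gₙ)` whenever `Φ(G₁,…,Gₙ) ∈ ℕ` and `Fᵢ`, `Gᵢ` are equal
on `Xᵢ` for all `i`. -/
def CountablyBased {σ : Ty} (Φ : Par σ) : Prop :=
  ∀ F : Args σ, (∃ k, Φ.eval F = some k) →
    ∃ X : Supp σ, X.Countable ∧
      ∀ G : Args σ, (∃ k, Φ.eval G = some k) → X.Agree F G → Φ.eval F = Φ.eval G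

end PartialFun

namespace PartialFun

/-! ### Closeness of total functionals: agreement on countable sets -/

open Filter

/-! Let the neighbourhoods of a total functional be given by agreement on countable sets. Then `Φ`
is countably based iff near any point where it is defined it takes no other value, though it may be
undefined there. To induct on terms, this is relativised to parameters `w : W` with filters `N w`:
in `CoherentFam N A B` the values of `A` are not contradicted nearby by `B`. A λ-abstraction adjoins
its bound variable to the parameters. The variable has rank at most two, so its arguments are fixed
by countably many numbers, and evaluating it is coherent (`CoherentFam.toPar_snd`). An application
depends on its argument only through countably many values, and the filters are closed under
countable intersections (`CoherentFam.app`). For μ, having two families pays off: one side can be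
cut down to the points where coherence holds while the other remains the full fixed point
(`CoherentFam.lfp`). Restrictions of countably based functionals are countably based, which handles
`⪯`. -/

/-- The filter of sets of total functionals generated by agreement with `f` on countable sets. -/
def Tot.cnhds {σ : Ty} (f : Tot σ) : Filter (Tot σ) where
  sets := {S | ∃ X : Set (Args σ), X.Countable ∧ ∀ g : Tot σ, (∀ a ∈ X, f.eval a = g.eval a) → g ∈ S}
  univ_sets := ⟨∅, Set.countable_empty, fun _ _ => trivial⟩
  sets_of_superset := fun ⟨X, hX, h⟩ hST => ⟨X, hX, fun g hg => hST (h g hg)⟩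
  inter_sets := fun ⟨X, hX, h⟩ ⟨Y, hY, h'⟩ => ⟨X ∪ Y, hX.union hY, fun g hg =>
    ⟨h g fun a ha => hg a (Or.inl ha), h' g fun a ha => hg a (Or.inr ha)⟩⟩

theorem Tot.pure_le_cnhds {σ : Ty} (f : Tot σ) : pure f ≤ f.cnhds := by
  rintro S ⟨X, _, h⟩
  exact h f fun _ _ => rfl

theorem Tot.eventually_eval_eq {σ : Ty} (f : Tot σ) (a : Args σ) :
    ∀ᶠ g in f.cnhds, f.eval a = g.eval a :=
  ⟨{a}, Set.countable_singleton a, fun _ h => h a rfl⟩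

theorem Tot.ext_eval {σ : Ty} {f g : Tot σ} (h : ∀ a, f.eval a = g.eval a) : f = g :=
  Tot.toPar_injective <| Par.ext_eval fun a => by rw [Tot.eval_toPar, Tot.eval_toPar, h]

/-- The product of the filters `Tot.cnhds` of the components of a tuple of arguments. -/
def Args.cnhds : {σ : Ty} → Args σ → Filter (Args σ)
  | .nat, _ => (⊤ : Filter Unit)
  | .arr _ _, a => Tot.cnhds a.1 ×ˢ Args.cnhds a.2

theorem Args.pure_le_cnhds : {σ : Ty} → (a : Args σ) → pure a ≤ a.cnhds
  | .nat, _ => le_top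
  | .arr _ _, a => by
    have h := Filter.prod_mono (Tot.pure_le_cnhds a.1) (Args.pure_le_cnhds a.2)
    rw [Filter.prod_pure_pure] at h
    exact h

theorem Supp.eventually_agree : {σ : Ty} → (X : Supp σ) → X.Countable → (a : Args σ) →
    ∀ᶠ b in a.cnhds, X.Agree a b
  | .nat, _, _, _ => Eventually.of_forall fun _ => trivial
  | .arr _ _, X, hX, a => by
    have h₁ : ∀ᶠ g in Tot.cnhds a.1, ∀ c ∈ X.1, a.1.eval c = g.eval c := ⟨X.1, hX.1, fun _ h => h⟩
    exact h₁.prod_mk (Supp.eventually_agree X.2 hX.2 a.2)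

/-- Converse of `Supp.eventually_agree`; the two translate between filters and countable supports.
-/
theorem Supp.exists_of_eventually : {σ : Ty} → {a : Args σ} → {S : Set (Args σ)} → S ∈ a.cnhds →
    ∃ X : Supp σ, X.Countable ∧ ∀ b, X.Agree a b → b ∈ S
  | .nat, _, _, hS => ⟨(), trivial, fun b _ => by
      have h : _ = (Set.univ : Set Unit) := Filter.mem_top.1 hS
      exact h.symm ▸ Set.mem_univ (α := Unit) b⟩
  | .arr _ _, a, S, hS => by
    obtain ⟨U, hU, V, hV, h⟩ := Filter.mem_prod_iff.1 hS
    obtain ⟨X, hX, hXU⟩ := hU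
    obtain ⟨Y, hY, hYV⟩ := Supp.exists_of_eventually hV
    exact ⟨(X, Y), ⟨hX, hY⟩, fun b hb => h ⟨hXU _ hb.1, hYV _ hb.2⟩⟩

theorem Args.countable_of_rank_le_one : {σ : Ty} → σ.rank ≤ 1 → Countable (Args σ)
  | .nat, _ => inferInstanceAs (Countable Unit)
  | .arr .nat _, h => by
    have := Args.countable_of_rank_le_one (le_trans (le_max_right _ _) h)
    exact inferInstanceAs (Countable (ℕ × Args _))
  | .arr (.arr _ _) _, h => by
    have h' := le_trans (le_max_left _ _) h
    simp only [Ty.rank] at h'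
    omega

/-- There are only countably many argument tuples, so the whole domain may serve as the countable
set. -/
theorem Tot.cnhds_le_pure {σ : Ty} (hσ : σ.rank ≤ 1) (f : Tot σ) : f.cnhds ≤ pure f := by
  have := Args.countable_of_rank_le_one hσ
  intro S hS
  refine ⟨Set.univ, Set.countable_univ, fun g hg => ?_⟩
  rw [← Tot.ext_eval fun a => hg a trivial]
  exact hS

theorem Args.cnhds_le_pure : {σ : Ty} → σ.rank ≤ 2 → (a : Args σ) → a.cnhds ≤ pure a
  | .nat, _, _ => fun S hS => by
    refine Filter.mem_top.2 (Set.eq_univ_of_forall fun b => ?_)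
    exact hS
  | .arr σ τ, h, a => by
    have h₁ : σ.rank ≤ 1 := by have := le_trans (le_max_left _ _) h; omega
    have := Filter.prod_mono (Tot.cnhds_le_pure h₁ a.1)
      (Args.cnhds_le_pure (le_trans (le_max_right _ _) h) a.2)
    rw [Filter.prod_pure_pure] at this
    exact this

/-! ### Coherent families and their closure properties -/

section Families

variable {W : Type} (N : W → Filter W)

/-- The values of the family `A` of partial functionals are eventually, in the sense of the filters
`N w` and `Args.cnhds`, not contradicted by the family `B`. -/
def CoherentFam {σ : Ty} (A B : W → Par σ) : Prop :=
  ∀ (w : W) (a : Args σ) (k : ℕ), (A w).eval a = some k →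
    ∀ᶠ p in N w ×ˢ a.cnhds, ∀ k', (B p.1).eval p.2 = some k' → k' = k

/-- Families of assignments that are componentwise coherent. -/
def CoherentEnv (A B : W → Env) : Prop :=
  ∀ σ i, CoherentFam N (fun w => A w σ i) (fun w => B w σ i)

variable {N}

theorem CoherentFam.bot {σ : Ty} (B : W → Par σ) : CoherentFam N (fun _ => Par.bot σ) B := by
  intro w a k h
  rw [Par.eval_bot] at h
  cases h

theorem CountablyBased.coherentFam {σ : Ty} {φ : Par σ} (h : CountablyBased φ) :
    CoherentFam N (fun _ => φ) (fun _ => φ) := by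
  intro w a k hk
  obtain ⟨X, hX, hX'⟩ := h a ⟨k, hk⟩
  refine ((X.eventually_agree hX a).prod_inr (N w)).mono fun p hb k' hk' => ?_
  have := hX' p.2 ⟨k', hk'⟩ hb
  rw [hk, hk'] at this
  exact (Option.some.inj this).symm

/-- A partial functional of rank at most two is coherent with itself. -/
theorem CoherentFam.const_of_rank_le_two {σ : Ty} (hσ : σ.rank ≤ 2) (φ : Par σ) :
    CoherentFam N (fun _ => φ) (fun _ => φ) := by
  intro w a k hk
  have h : ∀ᶠ b in a.cnhds, b = a := Args.cnhds_le_pure hσ a (Filter.mem_pure.2 rfl)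
  refine (h.prod_inr (N w)).mono fun p hb k' hk' => ?_
  rw [hb, hk] at hk'
  exact (Option.some.inj hk').symm

/-- The family of all total functionals of a type of rank at most two is coherent. -/
theorem CoherentFam.toPar_snd {σ : Ty} (hσ : σ.rank ≤ 2) :
    CoherentFam (fun w : W × Tot σ => N w.1 ×ˢ w.2.cnhds)
      (fun w => w.2.toPar) (fun w => w.2.toPar) := by
  intro w a k hk
  -- The filter at `a` is discrete, so only the functional varies, and nearby functionals keep its
  -- value at `a`.
  have h : ∀ᶠ b in a.cnhds, b = a := Args.cnhds_le_pure hσ a (Filter.mem_pure.2 rfl)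
  refine (((w.2.eventually_eval_eq a).prod_inr (N w.1)).prod_mk h).mono ?_
  rintro ⟨⟨w', g⟩, b⟩ ⟨hg, rfl⟩ k' hk'
  simp only [Tot.eval_toPar, Option.some.injEq] at hk hk'
  rw [← hk, ← hk']
  exact hg.symm

/-- Weakening: a coherent family stays so if its index set is enlarged. -/
theorem CoherentFam.comp_fst {V : Type} {M : V → Filter V} {σ : Ty} {A B : W → Par σ}
    (h : CoherentFam N A B) :
    CoherentFam (fun w : W × V => N w.1 ×ˢ M w.2) (fun w => A w.1) (fun w => B w.1) :=
  fun w a k hk => (tendsto_fst.prodMap tendsto_id).eventually (h w.1 a k hk)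

theorem CoherentEnv.set {A B : W → Env} (h : CoherentEnv N A B) (i : ℕ) {σ : Ty}
    {φ ψ : W → Par σ} (h' : CoherentFam N φ ψ) :
    CoherentEnv N (fun w => (A w).set i σ (φ w)) (fun w => (B w).set i σ (ψ w)) := by
  intro τ j
  unfold Env.set
  by_cases e : σ = τ ∧ i = j
  · obtain ⟨rfl, rfl⟩ := e
    simpa using h'
  · simpa [e] using h τ j

/-- An argument of the functional and a parameter play the same role; only the bracketing of the
product filter changes. -/
theorem CoherentFam.lam {σ τ : Ty} {A B : W → Par (.arr σ τ)}
    (h : CoherentFam (fun w : W × Tot σ => N w.1 ×ˢ w.2.cnhds)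
      (fun w => A w.1 w.2) (fun w => B w.1 w.2)) : CoherentFam N A B := by
  intro w a k hk
  have := h (w, a.1) a.2 k hk
  exact (Filter.tendsto_prodAssoc_symm.eventually this)

/-- If `C w` is a total `f`, coherence of `A` and `B` near `f` involves a countable set `X` of
arguments. Countably many instances of coherence of `C` and `D` make every nearby total `D v` agree
with `f` on `X`. -/
theorem CoherentFam.app [∀ w, CountableInterFilter (N w)] {σ τ : Ty} {A B : W → Par (.arr σ τ)}
    {C D : W → Par σ} (h : CoherentFam N A B) (h' : CoherentFam N C D) :
    CoherentFam N (fun w => (A w).app (C w)) (fun w => (B w).app (D w)) := by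
  intro w a k hk
  by_cases ht : ∃ f : Tot σ, f.toPar = C w
  swap
  · simp only [Par.app_eq_bot _ ht, Par.eval_bot] at hk
    cases hk
  obtain ⟨f, hf⟩ := ht
  simp only [← hf, Par.app_toPar] at hk
  have hA : ∀ᶠ p in N w ×ˢ (f.cnhds ×ˢ a.cnhds), ∀ k',
      ((B p.1) p.2.1).eval p.2.2 = some k' → k' = k := h w (f, a) k hk
  obtain ⟨U, hU, V, hV, hUV⟩ := Filter.mem_prod_iff.1 hA
  obtain ⟨V₁, ⟨X, hX, hXV⟩, V₂, hV₂, hV⟩ := Filter.mem_prod_iff.1 hV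
  have hD : ∀ᶠ v in N w, ∀ c ∈ X, ∀ k', (D v).eval c = some k' → k' = f.eval c := by
    refine (eventually_countable_ball hX).2 fun c _ => ?_
    have hc := h' w c (f.eval c) (by simp only [← hf, Tot.eval_toPar])
    -- The argument is frozen at `c` itself, leaving a condition on the parameter alone.
    refine Filter.Eventually.curry hc |>.mono fun v hv => ?_
    exact Args.pure_le_cnhds c hv
  refine ((Filter.Eventually.and hU hD).prod_mk hV₂).mono ?_
  rintro ⟨v, b⟩ ⟨⟨hvU, hv⟩, hb⟩ k' hk'
  by_cases hg : ∃ g : Tot σ, g.toPar = D v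
  · obtain ⟨g, hg⟩ := hg
    simp only [← hg, Par.app_toPar] at hk'
    have hgV : g ∈ V₁ := hXV g fun c hc =>
      (hv c hc (g.eval c) (by rw [← hg, Tot.eval_toPar])).symm
    exact hUV (show (v, (g, b)) ∈ U ×ˢ V from ⟨hvU, hV ⟨hgV, hb⟩⟩) k' hk'
  · simp only [Par.app_eq_bot _ hg, Par.eval_bot] at hk'
    cases hk'

/-- No transfinite iteration is needed. Let `D` be `lfp S` restricted to its good points, so that
`D` is coherent with `lfp T`. Then `S D` is coherent with `T (lfp T) = lfp T` and lies below `lfp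
S`, hence is defined only at good points. Thus `S D ≤ D`, and minimality gives `lfp S ≤ D`. -/
theorem CoherentFam.lfp {σ : Ty} {S T : W → Par σ → Par σ}
    (hS : ∀ w φ ψ, φ.Le ψ → (S w φ).Le (S w ψ)) (hT : ∀ w φ ψ, φ.Le ψ → (T w φ).Le (T w ψ))
    (h : ∀ A B : W → Par σ, CoherentFam N A B →
      CoherentFam N (fun w => S w (A w)) (fun w => T w (B w))) :
    CoherentFam N (fun w => Par.lfp (S w)) (fun w => Par.lfp (T w)) := by
  classical
  let good (w : W) (a : Args σ) : Prop := ∀ k, (Par.lfp (S w)).eval a = some k →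
    ∀ᶠ p in N w ×ˢ a.cnhds, ∀ k', (Par.lfp (T p.1)).eval p.2 = some k' → k' = k
  let D (w : W) : Par σ := Par.ofEval fun a =>
    if good w a then (Par.lfp (S w)).eval a else none
  have hD (w a) : (D w).eval a = if good w a then (Par.lfp (S w)).eval a else none :=
    Par.eval_ofEval _ _
  have hDle (w) : (D w).Le (Par.lfp (S w)) := by
    intro a k hk
    rw [hD] at hk
    split_ifs at hk
    exact hk
  have hDT : CoherentFam N D (fun w => Par.lfp (T w)) := by
    intro w a k hk
    rw [hD] at hk
    split_ifs at hk with hg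
    exact hg k hk
  have hST := h _ _ hDT
  simp only [fun w => (Par.lfp_spec (T w) (hT w)).1] at hST
  have hpre (w) : (S w (D w)).Le (D w) := by
    intro a k hk
    have hk' := hS w _ _ (hDle w) a k hk
    rw [(Par.lfp_spec (S w) (hS w)).1] at hk'
    have hg : good w a := fun l hl => by
      rw [hk'] at hl
      cases hl
      exact hST w a k hk
    rw [hD, if_pos hg, hk']
  intro w a k hk
  exact hDT w a k (Par.lfp_le (S w) (hS w) (hpre w) a k hk)

/-- Nearby the selector, if defined, is unchanged, so the same branch is selected. -/
theorem CoherentFam.caseVal {A₁ A₂ A₃ B₁ B₂ B₃ : W → Par .nat} (h₁ : CoherentFam N A₁ B₁)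
    (h₂ : CoherentFam N A₂ B₂) (h₃ : CoherentFam N A₃ B₃) :
    CoherentFam (σ := .nat) N (fun w => PartialFun.caseVal (A₁ w) (A₂ w) (A₃ w))
      (fun w => PartialFun.caseVal (B₁ w) (B₂ w) (B₃ w)) := by
  intro w a k hk
  change PartialFun.caseVal (A₁ w) (A₂ w) (A₃ w) = some k at hk
  match e : A₁ w with
  | none => rw [e] at hk; cases hk
  | some 0 =>
    rw [e] at hk
    filter_upwards [h₁ w a 0 e, h₂ w a k hk] with p hp₁ hp₂ k' hk'
    change PartialFun.caseVal (B₁ p.1) (B₂ p.1) (B₃ p.1) = some k' at hk'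
    match e' : B₁ p.1 with
    | none => rw [e'] at hk'; cases hk'
    | some 0 => rw [e'] at hk'; exact hp₂ k' hk'
    | some (m + 1) => exact absurd (hp₁ (m + 1) e') (Nat.succ_ne_zero m)
  | some (n + 1) =>
    rw [e] at hk
    filter_upwards [h₁ w a (n + 1) e, h₃ w a k hk] with p hp₁ hp₃ k' hk'
    change PartialFun.caseVal (B₁ p.1) (B₂ p.1) (B₃ p.1) = some k' at hk'
    match e' : B₁ p.1 with
    | none => rw [e'] at hk'; cases hk'
    | some 0 => exact absurd (hp₁ 0 e') (Nat.succ_ne_zero n).symm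
    | some (m + 1) => rw [e'] at hk'; exact hp₃ k' hk'

end Families

/-! ### Coherence of terms and the conclusion -/

theorem CoherentFam.countablyBased {σ : Ty} {φ : Par σ}
    (h : CoherentFam (fun _ : Unit => ⊤) (fun _ => φ) (fun _ => φ)) : CountablyBased φ := by
  rintro a ⟨k, hk⟩
  have h' : ∀ᶠ b in a.cnhds, ∀ k', φ.eval b = some k' → k' = k :=
    by
    simpa using (h () a k hk).curry
  obtain ⟨X, hX, hX'⟩ := Supp.exists_of_eventually h'
  refine ⟨X, hX, fun b ⟨k', hk'⟩ hb => ?_⟩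
  rw [hk, hk', hX' b hb k' hk']

instance Tot.countableInterFilter_cnhds {σ : Ty} (f : Tot σ) : CountableInterFilter f.cnhds where
  countable_sInter_mem S hS h := by
    choose! X hX hX' using h
    refine ⟨⋃ s ∈ S, X s, hS.biUnion hX, fun g hg s hs => hX' s hs g fun a ha => hg a ?_⟩
    exact Set.mem_biUnion hs ha

/-- Terms preserve coherence, if countably based functionals are substituted for variables. -/
theorem Term.coherentFam_interp_subst {σ : Ty} (t : Term σ) (ht : t.NoConst) :
    ∀ (θ : Repl), (∀ τ j φ, θ τ j = some φ → CountablyBased φ) →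
    ∀ {W : Type} (N : W → Filter W) [∀ w, CountableInterFilter (N w)] (A B : W → Env),
    CoherentEnv N A B →
      CoherentFam N (fun w => (t.subst θ).interp (A w)) (fun w => (t.subst θ).interp (B w)) := by
  have erase {θ : Repl} (hθ : ∀ τ j φ, θ τ j = some φ → CountablyBased φ) (i σ) :
      ∀ τ j φ, θ.erase i σ τ j = some φ → CountablyBased φ := by
    intro τ j φ h
    unfold Repl.erase at h
    split_ifs at h
    exact hθ τ j φ h
  induction t with
  | zero =>
    exact fun θ _ W N _ A B _ => .const_of_rank_le_two (by decide)
      (Term.zero.interp fun τ _ => Par.bot τ)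
  | suc =>
    exact fun θ _ W N _ A B _ => .const_of_rank_le_two (by decide)
      (Term.suc.interp fun τ _ => Par.bot τ)
  | pred =>
    exact fun θ _ W N _ A B _ => .const_of_rank_le_two (by decide)
      (Term.pred.interp fun τ _ => Par.bot τ)
  | case =>
    exact fun θ _ W N _ A B _ => .const_of_rank_le_two (by decide)
      (Term.case.interp fun τ _ => Par.bot τ)
  | caseOf t₁ t₂ t₃ h₁ h₂ h₃ =>
    exact fun θ hθ W N _ A B h => .caseVal (h₁ ht.1 θ hθ N A B h) (h₂ ht.2.1 θ hθ N A B h)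
      (h₃ ht.2.2 θ hθ N A B h)
  | var i σ hσ =>
    intro θ hθ W N _ A B h
    simp only [Term.subst]
    split
    · exact h σ i
    · next φ e => exact (hθ σ i φ e).coherentFam
  | const hσ φ => exact ht.elim
  | app t s iht ihs =>
    exact fun θ hθ W N _ A B h => .app (iht ht.1 θ hθ N A B h) (ihs ht.2 θ hθ N A B h)
  | lam i σ hr t iht =>
    intro θ hθ W N _ A B h
    -- The rank bound on abstractions enters here: the bound variable has rank at most two.
    have hσ : σ.rank ≤ 2 := by have := le_trans (le_max_left _ _) hr; omega
    have (w : W × Tot σ) : CountableInterFilter (N w.1 ×ˢ w.2.cnhds) := by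
      unfold SProd.sprod Filter.instSProd
      infer_instance
    have h' : CoherentEnv (fun w : W × Tot σ => N w.1 ×ˢ w.2.cnhds) (fun w => A w.1)
        (fun w => B w.1) := fun τ j => (h τ j).comp_fst
    exact .lam (iht ht _ (erase hθ i σ) _ _ _ (h'.set i (.toPar_snd hσ)))
  | mu i σ hσ t iht =>
    intro θ hθ W N _ A B h
    have m (ρ : Env) (φ ψ : Par σ) (l : φ.Le ψ) :
        ((t.subst (θ.erase i σ)).interp (ρ.set i σ φ)).Le
          ((t.subst (θ.erase i σ)).interp (ρ.set i σ ψ)) :=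
      Term.interp_mono _ (Env.set_mono (fun _ _ => Par.Le.refl _) i σ l)
    exact .lfp (fun w => m (A w)) (fun w => m (B w)) fun φ ψ hφ =>
      iht ht _ (erase hθ i σ) _ _ _ (h.set i hφ)

theorem CountablyBased.of_le {σ : Ty} {φ ψ : Par σ} (h : φ.Le ψ) (hψ : CountablyBased ψ) :
    CountablyBased φ := by
  rintro a ⟨k, hk⟩
  obtain ⟨X, hX, hX'⟩ := hψ a ⟨k, h a k hk⟩
  refine ⟨X, hX, fun b ⟨k', hk'⟩ hb => ?_⟩
  have := hX' b ⟨k', h b k' hk'⟩ hb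
  rwa [h a k hk, h b k' hk', ← hk, ← hk'] at this

theorem Repl.countablyBased_of_ofList {n : ℕ} {σ : Fin n → Ty} {v : Fin n → ℕ}
    {φ : (i : Fin n) → Par (σ i)} (h : ∀ i, CountablyBased (φ i)) (τ : Ty) (j : ℕ) (ψ : Par τ)
    (hψ : Repl.ofList σ v φ τ j = some ψ) : CountablyBased ψ := by
  unfold Repl.ofList at hψ
  split_ifs at hψ with e
  obtain rfl := Option.some.inj hψ
  have cast {σ' τ' : Ty} (e : σ' = τ') {χ : Par σ'} (hχ : CountablyBased χ) :
      CountablyBased (e ▸ χ) := by subst e; exact hχ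
  exact cast _ (h _)

end PartialFun

theorem mainTheorem11 {τ : PartialFun.Ty} (hτ : τ.rank ≤ 3) (Φ : PartialFun.Par τ)
    {n : ℕ} (σ : Fin n → PartialFun.Ty) (hσ : ∀ i, (σ i).rank ≤ 3)
    (φ : (i : Fin n) → PartialFun.Par (σ i))
    (hcomp : PartialFun.Computable Φ σ φ)
    (hcb : ∀ i, PartialFun.CountablyBased (φ i)) :
    PartialFun.CountablyBased Φ := by
  obtain ⟨s, v, -, hs, -, hle⟩ := hcomp
  refine PartialFun.CountablyBased.of_le hle (PartialFun.CoherentFam.countablyBased ?_)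
  -- One-point parameter space; the everywhere undefined assignment is vacuously coherent.
  exact s.coherentFam_interp_subst hs _ (PartialFun.Repl.countablyBased_of_ofList hcb) _ _ _
    fun _ _ => PartialFun.CoherentFam.bot _
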